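/- Let $V$ be a finite nonempty set, $d\in\mathbb N$, and $\mathcal H_V=\bigotimes_{v\in V}\mathbb C^d$. A state is a positive semidefinite operator of trace $1$ on $\mathcal H_V$; an observable is a self-adjoint operator on $\mathcal H_V$. For a state $\rho$, a self-adjoint $A$ and $r\in\mathbb R$, put $\mathbb P_\rho(A\ge r)=\operatorname{tr}[\rho\{A\ge r\}]$, where $\{A\ge r\}$ is the projector onto the span of the eigenvectors of $A$ with eigenvalue at least $r$, and $\langle O\rangle_\sigma=\operatorname{tr}[\sigma O]$. For self-adjoint $H$ let $$\|H\|_L=2\max_{v\in V}\min_{H_{v^c}}\|H-H_{v^c}\otimes\mathbb I_v\|_\infty,$$ the minimum being over self-adjoint operators $H_{v^c}$ on $\bigotimes_{w\ne v}\mathbb C^d$, and for arbitrary $Z$ let $\|Z\|_L=\max\{\|\operatorname{Re}Z\|_L,\|\operatorname{Im}Z\|_L\}$, where $\operatorname{Re}Z=\frac12(Z+Z^\dagger)$ and $\operatorname{Im}Z=\frac1{2i}(Z-Z^\dagger)$. For $\alpha>1$ let $$D_\alpha(\rho\|\sigma)=\frac1{\alpha-1}\log\operatorname{tr}\Big[\big(\sigma^{\frac{1-\alpha}{2\alpha}}\rho\,\sigma^{\frac{1-\alpha}{2\alpha}}\big)^\alpha\Big]$$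 if the support of $\rho$ is contained in that of $\sigma$, and $D_\alpha(\rho\|\sigma)=+\infty$ otherwise. Conventions: $\log 0=-\infty$, $e^{-\infty}=0$, and $t/0=+\infty$ for $t>0$. Let $\sigma>0$ be a full-rank state on $\mathcal H_V$. (1) For every state $\rho$, every operator $0\le E\le\mathbb I$ and every $\alpha>1$, $$\operatorname{tr}[E\rho]\le\exp\Big(\frac{\alpha-1}{\alpha}\big(D_\alpha(\rho\|\sigma)+\log\operatorname{tr}[E\sigma]\big)\Big).$$ (2) Let $c,K>0$, let $O$ be an observable and $a>0$, and suppose that $$\mathbb P_\sigma\big(|O-\langle O\rangle_\sigma\mathbb I|\ge a|V|\big)\le K\exp\Big(-\frac{c\,a^2|V|}{\|\sigma^{-1/2}O\sigma^{1/2}\|_L^2}\Big).\qquad(\ast)$$ Then for every state $\rho$ and every $\alpha>1$, $$\mathbb P_\rho\big(|O-\langle O\rangle_\sigma\mathbb I|\ge a|V|\big)\le\exp\Big(\frac{\alpha-1}{\alpha}\Big(D_\alpha(\rho\|\sigma)-\frac{c\,a^2|V|}{\|\sigma^{-1/2}O\sigma^{1/2}\|_L^2}+\log K\Big)\Big).\qquad(\ast\ast)$$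 (3) In particular, if $\sigma$ satisfies Gaussian concentration with constants $c,K>0$, i.e. $(\ast)$ holds for all observables $O$ and all $a>0$, then $(\ast\ast)$ holds for all states $\rho$, all observables $O$, all $a>0$ and all $\alpha>1$. -/

import Mathlib

open scoped ComplexOrder

namespace QuditConcentration

noncomputable section

/-- Linear operators on the `|V|`-qudit space `⨂_{v ∈ V} ℂ^d`, written as matrices in the
computational basis, which is indexed by the configurations `V → Fin d`. -/
abbrev Op (V : Type*) (d : ℕ) : Type _ := Matrix (V → Fin d) (V → Fin d) ℂ

/-- A quantum state: a positive semidefinite operator of trace one. -/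
def IsState {V : Type*} [Fintype V] [DecidableEq V] {d : ℕ} (ρ : Op V d) : Prop :=
  ρ.PosSemidef ∧ ρ.trace = 1

/-- A POVM element: an operator `E` with `0 ≤ E ≤ 𝕀`. -/
def IsPOVMElement {V : Type*} [Fintype V] [DecidableEq V] {d : ℕ} (E : Op V d) : Prop :=
  E.PosSemidef ∧ (1 - E).PosSemidef

/-- The value `tr[σ O]`; it is real when `σ` and `O` are self-adjoint. -/
def expect {V : Type*} [Fintype V] [DecidableEq V] {d : ℕ} (σ O : Op V d) : ℝ :=
  ((σ * O).trace).re

/-- The power `A ^ p` of a positive semidefinite operator (functional calculus). -/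
def opPow {V : Type*} [Fintype V] [DecidableEq V] {d : ℕ} (A : Op V d) (p : ℝ) : Op V d :=
  cfc (fun x : ℝ => x ^ p) A

/-- The absolute value `|A|` of a self-adjoint operator (functional calculus). -/
def opAbs {V : Type*} [Fintype V] [DecidableEq V] {d : ℕ} (A : Op V d) : Op V d :=
  cfc (fun x : ℝ => |x|) A

open Classical in
/-- The projector `{A ≥ r}` onto the span of the eigenvectors of the self-adjoint operator `A`
whose eigenvalue is at least `r`. -/
def projGE {V : Type*} [Fintype V] [DecidableEq V] {d : ℕ} (A : Op V d) (r : ℝ) : Op V d :=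
  cfc (fun x : ℝ => if r ≤ x then (1 : ℝ) else 0) A

/-- `ℙ_σ(A ≥ r) = tr[σ {A ≥ r}]`. -/
def prob {V : Type*} [Fintype V] [DecidableEq V] {d : ℕ} (σ A : Op V d) (r : ℝ) : ℝ :=
  expect σ (projGE A r)

/-- `ℙ_ρ(|O - ⟨O⟩_σ 𝕀| ≥ r)`. -/
def deviationProb {V : Type*} [Fintype V] [DecidableEq V] {d : ℕ}
    (ρ σ O : Op V d) (r : ℝ) : ℝ :=
  prob ρ (opAbs (O - ((expect σ O : ℝ) : ℂ) • (1 : Op V d))) r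

/-- The operator norm for the Euclidean norm of the qudit space. -/
def opNorm {V : Type*} [Fintype V] [DecidableEq V] {d : ℕ} (A : Op V d) : ℝ :=
  ‖Matrix.toEuclideanCLM (𝕜 := ℂ) A‖

/-- `B ⊗ 𝕀_v`, for an operator `B` on the qudits other than `v`. -/
def tensorId {V : Type*} {d : ℕ} (v : V) (B : Op {w : V // w ≠ v} d) : Op V d :=
  fun x y => if x v = y v then B (fun w => x w) (fun w => y w) else 0

/-- The Lipschitz constant of a self-adjoint operator,
`2 max_v min_B ‖H - B ⊗ 𝕀_v‖`, over self-adjoint `B` on the qudits other than `v`. -/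
def lipSA {V : Type*} [Fintype V] [DecidableEq V] {d : ℕ} (H : Op V d) : ℝ :=
  2 * ⨆ v : V, ⨅ B : {B : Op {w : V // w ≠ v} d // B.IsHermitian},
    opNorm (H - tensorId v B.1)

/-- The Lipschitz constant of an arbitrary operator: the larger of those of its real part
`(Z + Zᴴ) / 2` and its imaginary part `(Z - Zᴴ) / (2 i)`. -/
def lip {V : Type*} [Fintype V] [DecidableEq V] {d : ℕ} (Z : Op V d) : ℝ :=
  max (lipSA (realPart Z : Op V d)) (lipSA (imaginaryPart Z : Op V d))

open Classical in
/-- The sandwiched Rényi divergence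
`D_α(ρ‖σ) = (α - 1)⁻¹ log tr[(σ^((1-α)/(2α)) ρ σ^((1-α)/(2α)))^α]`,
equal to `+∞` if the support (i.e. the range) of `ρ` is not contained in that of `σ`. -/
def renyiDiv {V : Type*} [Fintype V] [DecidableEq V] {d : ℕ} (α : ℝ) (ρ σ : Op V d) : EReal :=
  if LinearMap.range ρ.mulVecLin ≤ LinearMap.range σ.mulVecLin then
    ((1 / (α - 1) * Real.log
      ((opPow (opPow σ ((1 - α) / (2 * α)) * ρ * opPow σ ((1 - α) / (2 * α))) α).trace).re :
        ℝ) : EReal)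
  else ⊤

/-- The Gaussian rate `c a² |V| / ‖σ^(-1/2) O σ^(1/2)‖_L²`. It is computed in `[0, ∞]`, so it is
`∞` if the Lipschitz constant vanishes (and `c, a > 0`). -/
def gaussRate {V : Type*} [Fintype V] [DecidableEq V] {d : ℕ}
    (σ O : Op V d) (c a : ℝ) : ENNReal :=
  ENNReal.ofReal (c * a ^ 2 * Fintype.card V) /
    ENNReal.ofReal (lip (opPow σ (-(1 / 2)) * O * opPow σ (1 / 2))) ^ 2

/-- The Gaussian tail bound in the state `σ` for one observable `O` and one `a`:
`ℙ_σ(|O - ⟨O⟩_σ 𝕀| ≥ a |V|) ≤ K exp(-c a² |V| / ‖σ^(-1/2) O σ^(1/2)‖_L²)`. -/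
def GaussianTail {V : Type*} [Fintype V] [DecidableEq V] {d : ℕ}
    (σ O : Op V d) (c K a : ℝ) : Prop :=
  ((deviationProb σ σ O (a * Fintype.card V) : ℝ) : EReal) ≤
    (K : EReal) * (EReal.exp (-(gaussRate σ O c a : EReal)) : EReal)

/-- `σ` satisfies Gaussian concentration with constants `c`, `K`: the Gaussian tail bound holds
for all observables and all `a > 0`. -/
def GaussianConcentration {V : Type*} [Fintype V] [DecidableEq V] {d : ℕ}
    (σ : Op V d) (c K : ℝ) : Prop :=
  ∀ O : Op V d, O.IsHermitian → ∀ a : ℝ, 0 < a → GaussianTail σ O c K a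

/-- The transferred tail bound:
`ℙ_ρ(|O - ⟨O⟩_σ 𝕀| ≥ a |V|) ≤
  exp(((α-1)/α) (D_α(ρ‖σ) - c a² |V| / ‖σ^(-1/2) O σ^(1/2)‖_L² + log K))`. -/
def TransferredTail {V : Type*} [Fintype V] [DecidableEq V] {d : ℕ}
    (ρ σ O : Op V d) (c K a α : ℝ) : Prop :=
  ((deviationProb ρ σ O (a * Fintype.card V) : ℝ) : EReal) ≤
    (EReal.exp ((((α - 1) / α : ℝ) : EReal) *
      (renyiDiv α ρ σ - (gaussRate σ O c a : EReal) + ((Real.log K : ℝ) : EReal))) : EReal)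

end

end QuditConcentration

/-!
With `s = (α - 1) / (2α)`, the support inclusion gives
`tr[ρ E] = tr[(σ⁻ˢ ρ σ⁻ˢ) (σˢ E σˢ)]`. Hölder's inequality with exponents `α` and `α / (α - 1)`
turns the first factor into the Rényi trace functional. The second factor has the spectrum of
`√E σ²ˢ √E`, and as `√E` is a contraction, Jensen's trace inequality for `x ↦ x ^ (α / (α - 1))`
bounds its contribution by `tr[σ E]`. Concentration is transferred by taking for `E` the projector
onto the tail event.
-/

namespace QuditConcentration

section Matrix

open Matrix
open scoped MatrixOrder

section Spectral

variable {𝕜 m n : Type*} [RCLike 𝕜] [Fintype n] [DecidableEq n]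

lemma trace_conjTranspose_mul_mul_unitary (U : unitaryGroup n 𝕜) (B : Matrix n n 𝕜) :
    ((U : Matrix n n 𝕜)ᴴ * B * U).trace = B.trace := by
  rw [trace_mul_cycle, ← star_eq_conjTranspose, Unitary.mul_star_self_of_mem U.2, one_mul]

lemma conjTranspose_eigenvectorUnitary_mul_mul_apply_self {A : Matrix n n 𝕜}
    (hA : A.IsHermitian) (i : n) :
    ((hA.eigenvectorUnitary : Matrix n n 𝕜)ᴴ * A * (hA.eigenvectorUnitary : Matrix n n 𝕜)) i i =
      hA.eigenvalues i := by
  have diagonalized := hA.conjStarAlgAut_star_eigenvectorUnitary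
  rw [Unitary.conjStarAlgAut_star_apply, star_eq_conjTranspose] at diagonalized
  rw [diagonalized, diagonal_apply_eq, Function.comp_apply]

lemma cfc_eq_eigenvectorUnitary_mul_diagonal_mul {A : Matrix n n 𝕜} (hA : A.IsHermitian)
    (f : ℝ → ℝ) :
    cfc f A = (hA.eigenvectorUnitary : Matrix n n 𝕜) *
      diagonal (RCLike.ofReal ∘ f ∘ hA.eigenvalues) *
        (hA.eigenvectorUnitary : Matrix n n 𝕜)ᴴ := by
  rw [hA.cfc_eq, IsHermitian.cfc, Unitary.conjStarAlgAut_apply, star_eq_conjTranspose]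

lemma re_trace_cfc {A : Matrix n n 𝕜} (hA : A.IsHermitian) (f : ℝ → ℝ) :
    RCLike.re (cfc f A).trace = ∑ i, f (hA.eigenvalues i) := by
  rw [cfc_eq_eigenvectorUnitary_mul_diagonal_mul hA, trace_mul_comm, ← Matrix.mul_assoc,
    ← star_eq_conjTranspose, Unitary.coe_star_mul_self, one_mul, trace_diagonal, map_sum]
  simp only [Function.comp_apply, RCLike.ofReal_re]

lemma re_trace_cfc_conjTranspose_mul_self (C : Matrix n n 𝕜) (f : ℝ → ℝ) :
    RCLike.re (cfc f (Cᴴ * C)).trace = RCLike.re (cfc f (C * Cᴴ)).trace := by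
  have h₁ := isHermitian_conjTranspose_mul_self C
  have h₂ := isHermitian_mul_conjTranspose_self C
  rw [re_trace_cfc h₁, re_trace_cfc h₂,
    (h₁.eigenvalues_eq_eigenvalues_iff h₂).2 (charpoly_mul_comm _ _)]

lemma re_trace_mul_eq_sum_eigenvalues_mul {A : Matrix n n 𝕜} (hA : A.IsHermitian)
    (B : Matrix n n 𝕜) :
    RCLike.re (A * B).trace = ∑ i, hA.eigenvalues i *
      RCLike.re (((hA.eigenvectorUnitary : Matrix n n 𝕜)ᴴ * B *
        (hA.eigenvectorUnitary : Matrix n n 𝕜)) i i) := by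
  conv_lhs => rw [hA.spectral_theorem, Unitary.conjStarAlgAut_apply, Matrix.mul_assoc,
    Matrix.mul_assoc, Matrix.trace_mul_comm, Matrix.mul_assoc]
  rw [trace, map_sum]
  refine Finset.sum_congr rfl fun i _ => ?_
  rw [diag_apply, diagonal_mul, Function.comp_apply, RCLike.re_ofReal_mul, star_eq_conjTranspose]

lemma re_conjTranspose_mul_cfc_mul_apply {A : Matrix n n 𝕜} (hA : A.IsHermitian) (f : ℝ → ℝ)
    (M : Matrix n m 𝕜) (i : m) :
    RCLike.re ((Mᴴ * cfc f A * M) i i) =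
      ∑ j, ‖((hA.eigenvectorUnitary : Matrix n n 𝕜)ᴴ * M) j i‖ ^ 2 * f (hA.eigenvalues j) := by
  rw [cfc_eq_eigenvectorUnitary_mul_diagonal_mul hA]
  set U := (hA.eigenvectorUnitary : Matrix n n 𝕜)
  set D : Matrix n n 𝕜 := diagonal (RCLike.ofReal ∘ f ∘ hA.eigenvalues) with hD
  have conj_eq : Mᴴ * (U * D * Uᴴ) * M = (Uᴴ * M)ᴴ * (D * (Uᴴ * M)) := by
    simp only [conjTranspose_mul, conjTranspose_conjTranspose, Matrix.mul_assoc]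
  rw [conj_eq, Matrix.mul_apply, map_sum]
  refine Finset.sum_congr rfl fun j _ => ?_
  rw [hD, diagonal_mul, conjTranspose_apply, mul_left_comm, RCLike.star_def, RCLike.conj_mul,
    Function.comp_apply, RCLike.re_ofReal_mul, ← RCLike.ofReal_pow, RCLike.ofReal_re, mul_comm,
    Function.comp_apply]

end Spectral

section Jensen

variable {𝕜 m n : Type*} [RCLike 𝕜] [Fintype n] [DecidableEq n] {s : Set ℝ} {f : ℝ → ℝ}

lemma map_re_conjTranspose_mul_mul_apply_le (hf : ConvexOn ℝ s f) (h0 : 0 ∈ s) (hf0 : f 0 ≤ 0)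
    {A : Matrix n n 𝕜} (hA : A.IsHermitian) (hs : spectrum ℝ A ⊆ s) (M : Matrix n m 𝕜) {i : m}
    (hM : RCLike.re ((Mᴴ * M) i i) ≤ 1) :
    f (RCLike.re ((Mᴴ * A * M) i i)) ≤ RCLike.re ((Mᴴ * cfc f A * M) i i) := by
  have hA_sum := re_conjTranspose_mul_cfc_mul_apply hA id M i
  have h1_sum := re_conjTranspose_mul_cfc_mul_apply hA (fun _ => 1) M i
  rw [cfc_id ℝ A hA.isSelfAdjoint] at hA_sum
  rw [cfc_const_one ℝ A hA.isSelfAdjoint, Matrix.mul_one] at h1_sum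
  rw [hA_sum, re_conjTranspose_mul_cfc_mul_apply hA f]
  simp only [mul_one, id] at h1_sum ⊢
  set w : n → ℝ := fun j => ‖((hA.eigenvectorUnitary : Matrix n n 𝕜)ᴴ * M) j i‖ ^ 2
  have hw : 0 ≤ 1 - ∑ j, w j := sub_nonneg.2 (h1_sum ▸ hM)
  have jensen := hf.map_add_sum_le (t := Finset.univ) (w := w) (p := hA.eigenvalues)
    (fun j _ => sq_nonneg _) (sub_add_cancel _ _)
    (fun j _ => hs (hA.eigenvalues_mem_spectrum_real j)) hw h0
  simp only [smul_eq_mul, mul_zero, zero_add] at jensen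
  linarith [mul_nonpos_of_nonneg_of_nonpos hw hf0]

lemma re_trace_cfc_conjTranspose_mul_mul_le [Fintype m] [DecidableEq m] (hf : ConvexOn ℝ s f)
    (h0 : 0 ∈ s) (hf0 : f 0 ≤ 0) {A : Matrix n n 𝕜} (hA : A.IsHermitian)
    (hs : spectrum ℝ A ⊆ s) {K : Matrix n m 𝕜} (hK : (1 - Kᴴ * K).PosSemidef) :
    RCLike.re (cfc f (Kᴴ * A * K)).trace ≤ RCLike.re (Kᴴ * cfc f A * K).trace := by
  have hY : (Kᴴ * A * K).IsHermitian := isHermitian_conjTranspose_mul_mul K hA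
  rw [re_trace_cfc hY, ← trace_conjTranspose_mul_mul_unitary hY.eigenvectorUnitary, trace, map_sum]
  have eigenvalue_eq := conjTranspose_eigenvectorUnitary_mul_mul_apply_self hY
  have hWW : (hY.eigenvectorUnitary : Matrix m m 𝕜)ᴴ * hY.eigenvectorUnitary.1 = 1 :=
    Unitary.star_mul_self_of_mem hY.eigenvectorUnitary.2
  set W := (hY.eigenvectorUnitary : Matrix m m 𝕜)
  have conj_mul (B : Matrix n n 𝕜) : Wᴴ * (Kᴴ * B * K) * W = (K * W)ᴴ * B * (K * W) := by
    simp only [conjTranspose_mul, Matrix.mul_assoc]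
  refine Finset.sum_le_sum fun i _ => ?_
  have contraction : RCLike.re (((K * W)ᴴ * (K * W)) i i) ≤ 1 := by
    have compl_eq : Wᴴ * (1 - Kᴴ * K) * W = 1 - (K * W)ᴴ * (K * W) := by
      rw [Matrix.mul_sub, Matrix.sub_mul, mul_one, hWW, conjTranspose_mul]
      simp only [Matrix.mul_assoc]
    have h := (RCLike.nonneg_iff.1 ((hK.conjTranspose_mul_mul_same W).diag_nonneg (i := i))).1
    rwa [compl_eq, Matrix.sub_apply, one_apply_eq, map_sub, RCLike.one_re, sub_nonneg] at h
  rw [← RCLike.ofReal_re (K := 𝕜) (hY.eigenvalues i), ← eigenvalue_eq, diag_apply, conj_mul,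
    conj_mul]
  exact map_re_conjTranspose_mul_mul_apply_le hf h0 hf0 hA hs _ contraction

/-- Flipping `(√E P)ᴴ (√E P)` into `(√E P) (√E P)ᴴ` leaves the spectrum unchanged and turns `√E`
into a contraction conjugating `P Pᴴ`, to which Jensen's trace inequality applies. -/
lemma re_trace_cfc_conjTranspose_mul_effect_mul_le (hf : ConvexOn ℝ (Set.Ici 0) f) (hf0 : f 0 ≤ 0)
    {E : Matrix n n 𝕜} (hE : E.PosSemidef) (hE1 : (1 - E).PosSemidef) (P : Matrix n n 𝕜) :
    RCLike.re (cfc f (Pᴴ * E * P)).trace ≤ RCLike.re (cfc f (P * Pᴴ) * E).trace := by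
  set K := CFC.sqrt E
  have hKK : K * K = E := CFC.sqrt_mul_sqrt_self E hE.nonneg
  have hK : Kᴴ = K := (nonneg_iff_posSemidef.1 (CFC.sqrt_nonneg E)).isHermitian
  have hPP : (P * Pᴴ).PosSemidef := posSemidef_self_mul_conjTranspose P
  calc RCLike.re (cfc f (Pᴴ * E * P)).trace
      = RCLike.re (cfc f ((K * P)ᴴ * (K * P))).trace := by
        rw [conjTranspose_mul, hK, Matrix.mul_assoc Pᴴ K, ← Matrix.mul_assoc K K,
          hKK, Matrix.mul_assoc]
    _ = RCLike.re (cfc f (Kᴴ * (P * Pᴴ) * K)).trace := by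
        rw [re_trace_cfc_conjTranspose_mul_self, conjTranspose_mul, hK]
        simp only [Matrix.mul_assoc]
    _ ≤ RCLike.re (Kᴴ * cfc f (P * Pᴴ) * K).trace :=
        re_trace_cfc_conjTranspose_mul_mul_le hf Set.self_mem_Ici hf0 hPP.1
          (fun _ hx => spectrum_nonneg_of_nonneg hPP.nonneg hx) (by rwa [hK, hKK])
    _ = RCLike.re (cfc f (P * Pᴴ) * E).trace := by
        rw [hK, Matrix.mul_assoc, trace_mul_comm, Matrix.mul_assoc, hKK]

end Jensen

section Power

variable {𝕜 n : Type*} [RCLike 𝕜] [Fintype n] [DecidableEq n]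

lemma posSemidef_cfc_rpow {A : Matrix n n 𝕜} (hA : A.PosSemidef) (p : ℝ) :
    (cfc (fun x : ℝ => x ^ p) A).PosSemidef :=
  nonneg_iff_posSemidef.1 <|
    cfc_nonneg fun _ hx => Real.rpow_nonneg (spectrum_nonneg_of_nonneg hA.nonneg hx) p

lemma re_trace_cfc_rpow_nonneg {A : Matrix n n 𝕜} (hA : A.PosSemidef) (p : ℝ) :
    0 ≤ RCLike.re (cfc (fun x : ℝ => x ^ p) A).trace :=
  (RCLike.nonneg_iff.1 (posSemidef_cfc_rpow hA p).trace_nonneg).1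

lemma cfc_rpow_cfc_rpow {A : Matrix n n 𝕜} (hA : A.PosSemidef) (s t : ℝ) :
    cfc (fun x : ℝ => x ^ t) (cfc (fun x : ℝ => x ^ s) A) = cfc (fun x : ℝ => x ^ (s * t)) A := by
  rw [← cfc_comp' (fun x : ℝ => x ^ t) (fun x : ℝ => x ^ s) A
    ((A.finite_real_spectrum.image _).continuousOn _) (A.finite_real_spectrum.continuousOn _)
    hA.1.isSelfAdjoint]
  exact cfc_congr fun x hx => (Real.rpow_mul (spectrum_nonneg_of_nonneg hA.nonneg hx) s t).symm

lemma cfc_rpow_mul_cfc_rpow {A : Matrix n n 𝕜} (hA : A.PosSemidef) {s t : ℝ} (hst : s + t ≠ 0) :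
    cfc (fun x : ℝ => x ^ s) A * cfc (fun x : ℝ => x ^ t) A = cfc (fun x : ℝ => x ^ (s + t)) A := by
  rw [← cfc_mul _ _ A (A.finite_real_spectrum.continuousOn _)
    (A.finite_real_spectrum.continuousOn _)]
  exact cfc_congr fun x hx =>
    (Real.rpow_add' (spectrum_nonneg_of_nonneg hA.nonneg hx) hst).symm

lemma cfc_rpow_one {A : Matrix n n 𝕜} (hA : A.IsHermitian) :
    cfc (fun x : ℝ => x ^ (1 : ℝ)) A = A := by
  simp only [Real.rpow_one]
  exact cfc_id' ℝ A hA.isSelfAdjoint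

lemma cfc_rpow_mul_cfc_rpow_neg_mul_self {A : Matrix n n 𝕜} (hA : A.PosSemidef) (s : ℝ) :
    cfc (fun x : ℝ => x ^ s) A * cfc (fun x : ℝ => x ^ (-s)) A * A = A := by
  have continuousOn_spectrum (f : ℝ → ℝ) : ContinuousOn f (spectrum ℝ A) :=
    A.finite_real_spectrum.continuousOn f
  suffices h : cfc (fun x : ℝ => x ^ s) A * cfc (fun x : ℝ => x ^ (-s)) A * cfc (fun x => x) A =
      cfc (fun x => x) A by rwa [cfc_id' ℝ A hA.1.isSelfAdjoint] at h
  rw [← cfc_mul _ _ A (continuousOn_spectrum _) (continuousOn_spectrum _),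
    ← cfc_mul _ _ A (continuousOn_spectrum _) (continuousOn_spectrum _)]
  refine cfc_congr fun x hx => ?_
  rcases (spectrum_nonneg_of_nonneg hA.nonneg hx).eq_or_lt with rfl | hx0
  · exact mul_zero _
  · rw [← Real.rpow_add hx0, add_neg_cancel, Real.rpow_zero, one_mul]

lemma mul_eq_self_of_range_mulVecLin_le {R k l m : Type*} [CommSemiring R] [Fintype k] [Fintype l]
    [Fintype m] {Q : Matrix m m R} {A : Matrix m k R} {B : Matrix m l R}
    (hAB : LinearMap.range A.mulVecLin ≤ LinearMap.range B.mulVecLin) (hQ : Q * B = B) :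
    Q * A = A := by
  refine ext_iff_mulVec.2 fun v => ?_
  obtain ⟨w, hw⟩ := hAB ⟨v, rfl⟩
  rw [mulVecLin_apply, mulVecLin_apply] at hw
  rw [← mulVec_mulVec, ← hw, mulVec_mulVec, hQ]

lemma trace_mul_eq_trace_sandwiched {ρ σ : Matrix n n 𝕜} (hρ : ρ.IsHermitian) (hσ : σ.PosSemidef)
    (hρσ : LinearMap.range ρ.mulVecLin ≤ LinearMap.range σ.mulVecLin) (E : Matrix n n 𝕜) (s : ℝ) :
    (ρ * E).trace =
      (cfc (fun x : ℝ => x ^ (-s)) σ * ρ * cfc (fun x : ℝ => x ^ (-s)) σ *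
        (cfc (fun x : ℝ => x ^ s) σ * E * cfc (fun x : ℝ => x ^ s) σ)).trace := by
  have support_mul := mul_eq_self_of_range_mulVecLin_le hρσ
    (cfc_rpow_mul_cfc_rpow_neg_mul_self hσ s)
  have hP := (posSemidef_cfc_rpow hσ s).isHermitian
  have hN := (posSemidef_cfc_rpow hσ (-s)).isHermitian
  set P := cfc (fun x : ℝ => x ^ s) σ
  set N := cfc (fun x : ℝ => x ^ (-s)) σ
  have mul_support : ρ * (N * P) = ρ := by
    simpa only [conjTranspose_mul, hP.eq, hN.eq, hρ.eq] using congrArg conjTranspose support_mul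
  calc (ρ * E).trace = (P * N * (ρ * (N * P)) * E).trace := by rw [mul_support, support_mul]
    _ = (P * (N * ρ * N * (P * E))).trace := by simp only [Matrix.mul_assoc]
    _ = (N * ρ * N * (P * E * P)).trace := by
        rw [trace_mul_comm, Matrix.mul_assoc, Matrix.mul_assoc]

end Power

section Holder

variable {𝕜 n : Type*} [RCLike 𝕜] [Fintype n]

lemma re_trace_mul_nonneg {A B : Matrix n n 𝕜} (hA : A.PosSemidef) (hB : B.PosSemidef) :
    0 ≤ RCLike.re (A * B).trace := by
  classical
  rw [re_trace_mul_eq_sum_eigenvalues_mul hA.1]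
  exact Finset.sum_nonneg fun i _ => mul_nonneg (hA.eigenvalues_nonneg i)
    (RCLike.nonneg_iff.1 (hB.conjTranspose_mul_mul_same _).diag_nonneg).1

variable [DecidableEq n]

lemma sum_re_conjTranspose_mul_mul_unitary_apply_rpow_le {B : Matrix n n 𝕜} (hB : B.PosSemidef)
    (U : unitaryGroup n 𝕜) {p : ℝ} (hp : 1 ≤ p) :
    ∑ i, RCLike.re (((U : Matrix n n 𝕜)ᴴ * B * (U : Matrix n n 𝕜)) i i) ^ p ≤
      RCLike.re (cfc (fun x : ℝ => x ^ p) B).trace := by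
  rw [← trace_conjTranspose_mul_mul_unitary U, trace, map_sum]
  have hU : (U : Matrix n n 𝕜)ᴴ * (U : Matrix n n 𝕜) = 1 := Unitary.star_mul_self_of_mem U.2
  refine Finset.sum_le_sum fun i _ =>
    map_re_conjTranspose_mul_mul_apply_le (convexOn_rpow hp) Set.self_mem_Ici
      (Real.zero_rpow (by linarith)).le hB.1
      (fun _ hx => spectrum_nonneg_of_nonneg hB.nonneg hx) _ ?_
  rw [hU, one_apply_eq, RCLike.one_re]

lemma re_trace_mul_le_rpow_mul_rpow {A B : Matrix n n 𝕜} (hA : A.PosSemidef) (hB : B.PosSemidef)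
    {p q : ℝ} (hpq : p.HolderConjugate q) :
    RCLike.re (A * B).trace ≤ RCLike.re (cfc (fun x : ℝ => x ^ p) A).trace ^ (1 / p) *
      RCLike.re (cfc (fun x : ℝ => x ^ q) B).trace ^ (1 / q) := by
  have hb (i : n) := (RCLike.nonneg_iff.1 ((hB.conjTranspose_mul_mul_same
    (hA.1.eigenvectorUnitary : Matrix n n 𝕜)).diag_nonneg (i := i))).1
  have peierls :=
    sum_re_conjTranspose_mul_mul_unitary_apply_rpow_le hB hA.1.eigenvectorUnitary hpq.symm.lt.le
  rw [re_trace_mul_eq_sum_eigenvalues_mul hA.1, re_trace_cfc hA.1]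
  refine (Real.inner_le_Lp_mul_Lq_of_nonneg Finset.univ hpq
    (fun i _ => hA.eigenvalues_nonneg i) (fun i _ => hb i)).trans ?_
  exact mul_le_mul_of_nonneg_left
    (Real.rpow_le_rpow (Finset.sum_nonneg fun i _ => Real.rpow_nonneg (hb i) q) peierls
      hpq.symm.one_div_nonneg)
    (Real.rpow_nonneg (Finset.sum_nonneg fun i _ => Real.rpow_nonneg (hA.eigenvalues_nonneg i) p) _)

theorem re_trace_mul_le_sandwiched {ρ σ E : Matrix n n 𝕜} (hρ : ρ.PosSemidef) (hσ : σ.PosSemidef)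
    (hρσ : LinearMap.range ρ.mulVecLin ≤ LinearMap.range σ.mulVecLin) (hE : E.PosSemidef)
    (hE1 : (1 - E).PosSemidef) {α : ℝ} (hα : 1 < α) :
    RCLike.re (ρ * E).trace ≤
      RCLike.re (cfc (fun x : ℝ => x ^ α) (cfc (fun x : ℝ => x ^ ((1 - α) / (2 * α))) σ * ρ *
        cfc (fun x : ℝ => x ^ ((1 - α) / (2 * α))) σ)).trace ^ (1 / α) *
      RCLike.re (σ * E).trace ^ ((α - 1) / α) := by
  have hα1 : 0 < α - 1 := sub_pos.2 hα
  set s : ℝ := (α - 1) / (2 * α) with hs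
  have hs0 : s + s ≠ 0 := by positivity
  have hpq : α.HolderConjugate (α / (α - 1)) := Real.HolderConjugate.conjExponent hα
  have hss : (s + s) * (α / (α - 1)) = 1 := by rw [hs]; field_simp; ring
  have hneg : (1 - α) / (2 * α) = -s := by rw [hs, ← neg_div, neg_sub]
  rw [hneg, trace_mul_eq_trace_sandwiched hρ.1 hσ hρσ E s, ← one_div_div α (α - 1)]
  have hP := (posSemidef_cfc_rpow hσ s).isHermitian
  have hN := (posSemidef_cfc_rpow hσ (-s)).isHermitian
  have hPP := cfc_rpow_mul_cfc_rpow hσ hs0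
  set P := cfc (fun x : ℝ => x ^ s) σ
  set N := cfc (fun x : ℝ => x ^ (-s)) σ
  have hNρN : (N * ρ * N).PosSemidef := by
    simpa only [hN.eq] using hρ.conjTranspose_mul_mul_same N
  have hPEP : (P * E * P).PosSemidef := by
    simpa only [hP.eq] using hE.conjTranspose_mul_mul_same P
  have trace_le : RCLike.re (cfc (fun x : ℝ => x ^ (α / (α - 1))) (P * E * P)).trace ≤
      RCLike.re (σ * E).trace := by
    have h := re_trace_cfc_conjTranspose_mul_effect_mul_le (convexOn_rpow hpq.symm.lt.le)
      (Real.zero_rpow hpq.symm.ne_zero).le hE hE1 P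
    rwa [hP.eq, hPP, cfc_rpow_cfc_rpow hσ, hss, cfc_rpow_one hσ.1] at h
  have h₁ := re_trace_cfc_rpow_nonneg hNρN α
  have h₂ := re_trace_cfc_rpow_nonneg hPEP (α / (α - 1))
  refine (re_trace_mul_le_rpow_mul_rpow hNρN hPEP hpq).trans ?_
  gcongr

end Holder

end Matrix

section State

open scoped MatrixOrder

variable {V : Type*} [Fintype V] [DecidableEq V] {d : ℕ} {ρ σ E O : Op V d} {α : ℝ}

/-- The sandwiched Rényi trace functional `tr[(σ^((1-α)/(2α)) ρ σ^((1-α)/(2α)))^α]`, whose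
logarithm is `(α - 1) D_α(ρ‖σ)` if the support of `ρ` is contained in that of `σ`. -/
noncomputable def renyiTrace (α : ℝ) (ρ σ : Op V d) : ℝ :=
  ((opPow (opPow σ ((1 - α) / (2 * α)) * ρ * opPow σ ((1 - α) / (2 * α))) α).trace).re

lemma renyiTrace_nonneg (hρ : ρ.PosSemidef) (hσ : σ.PosSemidef) : 0 ≤ renyiTrace α ρ σ := by
  have hσα : (opPow σ ((1 - α) / (2 * α))).IsHermitian := (posSemidef_cfc_rpow hσ _).isHermitian
  have sandwiched : (opPow σ ((1 - α) / (2 * α)) * ρ * opPow σ ((1 - α) / (2 * α))).PosSemidef := by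
    simpa only [hσα.eq] using hρ.conjTranspose_mul_mul_same (opPow σ ((1 - α) / (2 * α)))
  exact re_trace_cfc_rpow_nonneg sandwiched α

lemma renyiDiv_of_range_le (hρσ : LinearMap.range ρ.mulVecLin ≤ LinearMap.range σ.mulVecLin) :
    renyiDiv α ρ σ = ((1 / (α - 1) * Real.log (renyiTrace α ρ σ) : ℝ) : EReal) :=
  if_pos hρσ

lemma expect_nonneg (hσ : σ.PosSemidef) (hE : E.PosSemidef) : 0 ≤ expect σ E :=
  re_trace_mul_nonneg hσ hE

lemma expect_le_renyiTrace_rpow_mul (hρ : ρ.PosSemidef) (hσ : σ.PosSemidef)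
    (hρσ : LinearMap.range ρ.mulVecLin ≤ LinearMap.range σ.mulVecLin) (hE : IsPOVMElement E)
    (hα : 1 < α) :
    expect ρ E ≤ renyiTrace α ρ σ ^ (1 / α) * expect σ E ^ ((α - 1) / α) :=
  re_trace_mul_le_sandwiched hρ hσ hρσ hE.1 hE.2 hα

lemma ofReal_renyiTrace_rpow_le (hρ : ρ.PosSemidef) (hσ : σ.PosSemidef)
    (hρσ : LinearMap.range ρ.mulVecLin ≤ LinearMap.range σ.mulVecLin) (hα : 1 < α) :
    ENNReal.ofReal (renyiTrace α ρ σ ^ (1 / α)) ≤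
      EReal.exp (renyiDiv α ρ σ) ^ ((α - 1) / α) := by
  have hα1 : α - 1 ≠ 0 := (sub_pos.2 hα).ne'
  have exponent_eq : 1 / (α - 1) * Real.log (renyiTrace α ρ σ) * ((α - 1) / α) =
      Real.log (renyiTrace α ρ σ) * (1 / α) := by
    field_simp
  rw [renyiDiv_of_range_le hρσ, ← EReal.exp_mul, ← EReal.coe_mul, exponent_eq, EReal.exp_coe,
    Real.exp_mul]
  refine ENNReal.ofReal_le_ofReal ?_
  have := renyiTrace_nonneg (α := α) hρ hσ
  gcongr
  exact Real.le_exp_log _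

theorem expect_le_exp_of_expect_le_exp (hρ : ρ.PosSemidef) (hσ : σ.PosSemidef)
    (hρσ : LinearMap.range ρ.mulVecLin ≤ LinearMap.range σ.mulVecLin) (hE : IsPOVMElement E)
    (hα : 1 < α) {x : EReal} (hx : (expect σ E : EReal) ≤ EReal.exp x) :
    (expect ρ E : EReal) ≤
      EReal.exp ((((α - 1) / α : ℝ) : EReal) * (renyiDiv α ρ σ + x)) := by
  have hθ : 0 ≤ (α - 1) / α := div_nonneg (sub_pos.2 hα).le (by linarith)
  have hx' : ENNReal.ofReal (expect σ E) ≤ EReal.exp x := by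
    rw [← EReal.coe_ennreal_le_coe_ennreal_iff, EReal.coe_ennreal_ofReal,
      max_eq_left (expect_nonneg hσ hE.1)]
    exact hx
  have bound : ENNReal.ofReal (expect ρ E) ≤
      EReal.exp ((((α - 1) / α : ℝ) : EReal) * (renyiDiv α ρ σ + x)) :=
    calc ENNReal.ofReal (expect ρ E)
        ≤ ENNReal.ofReal (renyiTrace α ρ σ ^ (1 / α) * expect σ E ^ ((α - 1) / α)) :=
          ENNReal.ofReal_le_ofReal (expect_le_renyiTrace_rpow_mul hρ hσ hρσ hE hα)
      _ = ENNReal.ofReal (renyiTrace α ρ σ ^ (1 / α)) *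
            ENNReal.ofReal (expect σ E) ^ ((α - 1) / α) := by
          rw [ENNReal.ofReal_mul (Real.rpow_nonneg (renyiTrace_nonneg hρ hσ) _),
            ENNReal.ofReal_rpow_of_nonneg (expect_nonneg hσ hE.1) hθ]
      _ ≤ EReal.exp (renyiDiv α ρ σ) ^ ((α - 1) / α) * EReal.exp x ^ ((α - 1) / α) := by
          gcongr
          exact ofReal_renyiTrace_rpow_le hρ hσ hρσ hα
      _ = EReal.exp ((((α - 1) / α : ℝ) : EReal) * (renyiDiv α ρ σ + x)) := by
          rw [← ENNReal.mul_rpow_of_nonneg _ _ hθ, ← EReal.exp_add, mul_comm, EReal.exp_mul]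
  calc (expect ρ E : EReal) ≤ (ENNReal.ofReal (expect ρ E) : EReal) := by
        rw [EReal.coe_ennreal_ofReal]
        exact EReal.coe_le_coe_iff.2 (le_max_left _ _)
    _ ≤ _ := EReal.coe_ennreal_le_coe_ennreal_iff.2 bound

theorem expect_le_exp_renyiDiv_add_log (hρ : ρ.PosSemidef) (hσ : σ.PosSemidef)
    (hρσ : LinearMap.range ρ.mulVecLin ≤ LinearMap.range σ.mulVecLin) (hE : IsPOVMElement E)
    (hα : 1 < α) :
    (expect ρ E : EReal) ≤ EReal.exp ((((α - 1) / α : ℝ) : EReal) *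
      (renyiDiv α ρ σ + ENNReal.log (ENNReal.ofReal (expect σ E)))) := by
  refine expect_le_exp_of_expect_le_exp hρ hσ hρσ hE hα ?_
  rw [ENNReal.exp_log, EReal.coe_ennreal_ofReal]
  exact EReal.coe_le_coe_iff.2 (le_max_left _ _)

lemma isPOVMElement_projGE (A : Op V d) (r : ℝ) : IsPOVMElement (projGE A r) := by
  refine ⟨Matrix.nonneg_iff_posSemidef.1 (cfc_nonneg fun x _ => ?_),
    Matrix.le_iff.1 (cfc_le_one _ _ fun x _ => ?_)⟩ <;>
  split_ifs <;> norm_num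

theorem transferredTail_of_gaussianTail {c K a : ℝ} (hρ : ρ.PosSemidef) (hσ : σ.PosSemidef)
    (hρσ : LinearMap.range ρ.mulVecLin ≤ LinearMap.range σ.mulVecLin) (hK : 0 < K)
    (hO : GaussianTail σ O c K a) (hα : 1 < α) : TransferredTail ρ σ O c K a α := by
  have prefactor : (K : EReal) * (EReal.exp (-(gaussRate σ O c a : EReal)) : EReal) =
      EReal.exp (-(gaussRate σ O c a : EReal) + ((Real.log K : ℝ) : EReal)) := by
    rw [EReal.exp_add, EReal.exp_coe, Real.exp_log hK, EReal.coe_ennreal_mul,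
      EReal.coe_ennreal_ofReal, max_eq_left hK.le, mul_comm]
  rw [TransferredTail, sub_eq_add_neg (renyiDiv α ρ σ), add_assoc]
  exact expect_le_exp_of_expect_le_exp hρ hσ hρσ (isPOVMElement_projGE _ _) hα
    (hO.trans_eq prefactor)

end State

end QuditConcentration

open QuditConcentration in
/-- Negative powers of a singular `σ` are inverses on its support, since `0 ^ p = 0` for `p ≠ 0`. -/
theorem mainTheorem7_general {V : Type*} [Fintype V] [DecidableEq V] {d : ℕ} {σ : Op V d}
    (hσ : σ.PosSemidef) :
    (∀ ρ : Op V d, ρ.PosSemidef →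
      LinearMap.range ρ.mulVecLin ≤ LinearMap.range σ.mulVecLin →
      ∀ E : Op V d, IsPOVMElement E → ∀ α : ℝ, 1 < α →
        (expect ρ E : EReal) ≤ EReal.exp ((((α - 1) / α : ℝ) : EReal) *
          (renyiDiv α ρ σ + ENNReal.log (ENNReal.ofReal (expect σ E))))) ∧
    (∀ c K : ℝ, 0 < c → 0 < K → ∀ O : Op V d, O.IsHermitian → ∀ a : ℝ, GaussianTail σ O c K a →
      ∀ ρ : Op V d, ρ.PosSemidef →
      LinearMap.range ρ.mulVecLin ≤ LinearMap.range σ.mulVecLin →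
      ∀ α : ℝ, 1 < α → TransferredTail ρ σ O c K a α) :=
  ⟨fun _ hρ hρσ _ hE _ hα => expect_le_exp_renyiDiv_add_log hρ hσ hρσ hE hα,
    fun _ _ _ hK _ _ _ hO _ hρ hρσ _ hα => transferredTail_of_gaussianTail hρ hσ hρσ hK hO hα⟩

theorem mainTheorem7 {V : Type*} [Fintype V] [DecidableEq V] [Nonempty V] (d : ℕ)
    (σ : QuditConcentration.Op V d) (hσ : QuditConcentration.IsState σ) (hσpos : σ.PosDef) :
    (∀ ρ : QuditConcentration.Op V d, QuditConcentration.IsState ρ →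
      ∀ E : QuditConcentration.Op V d, QuditConcentration.IsPOVMElement E →
      ∀ α : ℝ, 1 < α →
        ((QuditConcentration.expect ρ E : ℝ) : EReal) ≤
          (EReal.exp ((((α - 1) / α : ℝ) : EReal) *
            (QuditConcentration.renyiDiv α ρ σ +
              ENNReal.log (ENNReal.ofReal (QuditConcentration.expect σ E)))) : EReal)) ∧
    (∀ c K : ℝ, 0 < c → 0 < K →
      ∀ O : QuditConcentration.Op V d, O.IsHermitian → ∀ a : ℝ, 0 < a →
      QuditConcentration.GaussianTail σ O c K a →
      ∀ ρ : QuditConcentration.Op V d, QuditConcentration.IsState ρ → ∀ α : ℝ, 1 < α →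
        QuditConcentration.TransferredTail ρ σ O c K a α) ∧
    (∀ c K : ℝ, 0 < c → 0 < K → QuditConcentration.GaussianConcentration σ c K →
      ∀ ρ : QuditConcentration.Op V d, QuditConcentration.IsState ρ →
      ∀ O : QuditConcentration.Op V d, O.IsHermitian → ∀ a : ℝ, 0 < a → ∀ α : ℝ, 1 < α →
        QuditConcentration.TransferredTail ρ σ O c K a α) := by
  have range_eq_top : LinearMap.range σ.mulVecLin = ⊤ :=
    LinearMap.range_eq_top.2 (Matrix.mulVec_surjective_iff_isUnit.2 hσpos.isUnit)
  have range_le (ρ : QuditConcentration.Op V d) :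
      LinearMap.range ρ.mulVecLin ≤ LinearMap.range σ.mulVecLin := range_eq_top ▸ le_top
  obtain ⟨expect_le, transferred⟩ := mainTheorem7_general hσ.1
  exact ⟨fun ρ hρ => expect_le ρ hρ.1 (range_le ρ),
    fun c K hc hK O hO a _ hT ρ hρ =>
      transferred c K hc hK O hO a hT ρ hρ.1 (range_le ρ),
    fun c K hc hK hG ρ hρ O hO a ha =>
      transferred c K hc hK O hO a (hG O hO a ha) ρ hρ.1 (range_le ρ)⟩
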